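/- Conventions. A variety over a field \(k\) is an integral scheme that is separated and of finite type over \(k\); a scheme is normal if all its local rings are integrally closed domains. A scheme \(X\) over \(k\) is geometrically normal (resp. geometrically reduced) over \(k\) if \(X \times_k K\) is normal (resp. reduced) for every field extension \(k \subset K\). Let \(k\) be a field of characteristic \(p > 0\) and let \(X\) be a variety over \(k\) such that \(k\) is algebraically closed in the function field \(K(X)\). An elemental extension \((k \subset l \subset k',\ \varphi : X' \to X)\) of \((k, X)\) consists of field extensions \(k \subset l \subset k'\) and a morphism of schemes \(\varphi : X' \to X\) such that: \(k \subset l\) is purely inseparable with \(l^p \subset k\); \(X \times_k l\) is integral; \(X'\) is the normalisation of \(X \times_k l\) and \(\varphi\) is the induced morphism \(X' \to X \times_k l \to X\); and \(k'\) is the algebraic closure of \(l\) in \(K(X')\). In particular \(X'\) is a scheme over \(k'\). Theorem. Let \(k_0\) be a field of characteristic \(p > 0\) and let \(X_0\) be a normal variety over \(k_0\) such that \(k_0\) is algebraically closed in \(K(X_0)\). Let \(n \geq 0\) and, for each \(i \in \{1, \dots, n\}\), let \((k_{i-1} \subset l_i \subset k_i,\ \varphi_i : X_i \to X_{i-1})\)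 be an elemental extension of \((k_{i-1}, X_{i-1})\). (1) Assume that \(X_n\) is geometrically normal over \(k_n\). Then the following are equivalent: (a) \(X_0\) is geometrically normal over \(k_0\); (b) \(X_{i-1} \times_{k_{i-1}} l_i\) is normal and \(l_i = k_i\) for every \(i \in \{1, \dots, n\}\). If moreover \(X_0\) is proper over \(k_0\), then each of (a) and (b) is equivalent to (c) \(X_{i-1} \times_{k_{i-1}} l_i\) is normal for every \(i \in \{1, \dots, n\}\). (2) Assume that \(X_n\) is geometrically reduced over \(k_n\). Then the following are equivalent: (a') \(X_0\) is geometrically reduced over \(k_0\); (b') \(l_i = k_i\) for every \(i \in \{1, \dots, n\}\). -/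

import Mathlib

open CategoryTheory CategoryTheory.Limits AlgebraicGeometry

universe u

noncomputable section

namespace ElementalExt

/-- A scheme is normal if all its local rings are integrally closed domains. -/
def IsNormalScheme (X : Scheme.{u}) : Prop :=
  ∀ x : X, IsDomain (X.presheaf.stalk x) ∧ IsIntegrallyClosed (X.presheaf.stalk x)

/-- The canonical morphism `Spec K(X) ⟶ X` of an irreducible scheme. -/
abbrev fromSpecFunctionField (X : Scheme.{u}) [IrreducibleSpace X] :
    Spec X.functionField ⟶ X :=
  X.fromSpecStalk (genericPoint X)

instance (X : Scheme.{u}) [IsIntegral X] : QuasiCompact (fromSpecFunctionField X) := by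
  refine ⟨fun U _ _ ↦ ?_⟩
  have : Subsingleton (Spec X.functionField) :=
    inferInstanceAs (Subsingleton (PrimeSpectrum X.functionField))
  exact (Set.toFinite _).isCompact

instance (X : Scheme.{u}) [IsIntegral X] : QuasiSeparated (fromSpecFunctionField X) := by
  infer_instance

/-- The normalisation of an integral scheme `Y`: the normalisation of `Y` in its generic point
`Spec K(Y)`, i.e. over an affine open `U` it is the spectrum of the integral closure of `Γ(Y, U)`
in the function field `K(Y)`. -/
def normalisation (Y : Scheme.{u}) [IsIntegral Y] : Scheme.{u} :=
  (fromSpecFunctionField Y).normalization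

/-- The structure morphism of the normalisation. -/
def fromNormalisation (Y : Scheme.{u}) [IsIntegral Y] : normalisation Y ⟶ Y :=
  (fromSpecFunctionField Y).fromNormalization

instance (Y : Scheme.{u}) [IsIntegral Y] : IsIntegral (normalisation Y) :=
  inferInstanceAs (IsIntegral (fromSpecFunctionField Y).normalization)

/-- `ν : X' ⟶ Y` is (isomorphic over `Y` to) the normalisation of the integral scheme `Y`. -/
def IsNormalisation {X' Y : Scheme.{u}} [IsIntegral Y] (ν : X' ⟶ Y) : Prop :=
  ∃ e : X' ≅ normalisation Y, e.hom ≫ fromNormalisation Y = ν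

lemma IsNormalisation.isIntegral {X' Y : Scheme.{u}} [IsIntegral Y] {ν : X' ⟶ Y}
    (h : IsNormalisation ν) : IsIntegral X' := by
  obtain ⟨e, -⟩ := h
  have : Nonempty X' := ⟨e.inv (genericPoint (normalisation Y))⟩
  exact isIntegral_of_isOpenImmersion e.hom

/-- The ring homomorphism `k →+* K(X)` induced by `α : X ⟶ Spec k`. -/
def toFunctionField {k : Type u} [Field k] {X : Scheme.{u}} [IsIntegral X]
    (α : X ⟶ Spec (.of k)) : k →+* X.functionField :=
  (X.presheaf.germ ⊤ (genericPoint X) trivial).hom.comp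
    (α.appTop.hom.comp (Scheme.ΓSpecIso (.of k)).inv.hom)

/-- For a homomorphism of fields `f : k →+* K`, the algebraic closure of `k` in `K`. -/
def algClosureIn {k K : Type u} [Field k] [Field K] (f : k →+* K) : Subfield K :=
  letI := f.toAlgebra
  (algebraicClosure k K).toSubfield

/-- A variety over `k`: an integral scheme, separated and of finite type over `k`. -/
structure IsVariety {k : Type u} [Field k] {X : Scheme.{u}} (α : X ⟶ Spec (.of k)) : Prop where
  isIntegral : IsIntegral X
  isSeparated : IsSeparated α
  quasiCompact : QuasiCompact α
  locallyOfFiniteType : LocallyOfFiniteType α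

/-- `α : X ⟶ Spec k` is a variety over `k` such that `k` is algebraically closed in `K(X)`. -/
structure IsVarietyWithClosedBase {k : Type u} [Field k] {X : Scheme.{u}}
    (α : X ⟶ Spec (.of k)) : Prop extends IsVariety α where
  algClosed : (toFunctionField α).fieldRange = algClosureIn (toFunctionField α)

/-- The base change `X ×ₖ l` of `α : X ⟶ Spec k` along a field extension `k ⊂ l`. -/
abbrev baseChange {k : Type u} [Field k] {X : Scheme.{u}} (α : X ⟶ Spec (.of k))
    (l : Type u) [Field l] [Algebra k l] : Scheme.{u} :=
  pullback α (Spec.map (CommRingCat.ofHom (algebraMap k l)))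

/-- `(k ⊂ l ⊂ k', φ : X' ⟶ X)` is an elemental extension of `(k, X)`, where `k` has
characteristic `p`, and `α : X ⟶ Spec k` and `α' : X' ⟶ Spec k'` are the structure morphisms. -/
structure IsElementalExtension (p : ℕ) {k l k' : Type u} [Field k] [Field l] [Field k']
    [Algebra k l] [Algebra l k'] {X X' : Scheme.{u}} (α : X ⟶ Spec (.of k))
    (α' : X' ⟶ Spec (.of k')) (φ : X' ⟶ X) : Prop where
  /-- `X` is a variety over `k` and `k` is algebraically closed in `K(X)`. -/
  isVarietyWithClosedBase : IsVarietyWithClosedBase α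
  /-- `k ⊂ l` is purely inseparable. -/
  isPurelyInseparable : IsPurelyInseparable k l
  /-- `l ^ p ⊂ k`. -/
  pow_mem : ∀ x : l, x ^ p ∈ (algebraMap k l).range
  /-- `X ×ₖ l` is integral. -/
  isIntegral_baseChange : IsIntegral (baseChange α l)
  /-- The square formed by `φ`, `α`, `α'` and `k ⊂ k'` commutes. -/
  comm : φ ≫ α = (α' ≫ Spec.map (CommRingCat.ofHom (algebraMap l k'))) ≫
    Spec.map (CommRingCat.ofHom (algebraMap k l))
  /-- The morphism `X' ⟶ X ×ₖ l` with components `φ` and `X' ⟶ Spec k' ⟶ Spec l` is the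
  normalisation of `X ×ₖ l`. -/
  isNormalisation : IsNormalisation
    (pullback.lift φ (α' ≫ Spec.map (CommRingCat.ofHom (algebraMap l k'))) comm :
      X' ⟶ baseChange α l)
  /-- `k'` is the algebraic closure of `l` in `K(X')`. -/
  algClosure :
    haveI := isNormalisation.isIntegral
    (toFunctionField α').fieldRange =
      algClosureIn (toFunctionField (α' ≫ Spec.map (CommRingCat.ofHom (algebraMap l k'))))

/-- `α : X ⟶ Spec k` is geometrically normal: `X ×ₖ K` is normal for every field extension
`k ⊂ K`. -/
def GeometricallyNormal {k : Type u} [Field k] {X : Scheme.{u}} (α : X ⟶ Spec (.of k)) : Prop :=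
  geometrically (fun Y : Scheme.{u} ↦ IsNormalScheme Y) α

end ElementalExt

end

/-!
For a single elemental extension, geometric normality and geometric reducedness ascend along
`X' ⟶ X ×ₖ l` and descend along base change, so both become equivalent for `X` and `X'` as soon as
`l = k'` and, for normality, `X' = X ×ₖ l`. The point is therefore the equality `l = k'`.

If `X` is geometrically reduced, then `F = K(X ×ₖ l)` is generated by `l` over `K = K(X)`, hence is
purely inseparable over `K`. As `k` is algebraically closed in `K`, the subfield `k'` of `F` is
purely inseparable over `k`, so every element of `K ⊗ₖ k'` has a power in `K` and the kernel of
`K ⊗ₖ k' ⟶ F` is nil, thus zero. Now `K ⊗ₖ l ⟶ F` is surjective, so `K ⊗ₖ l ⟶ K ⊗ₖ k'` is too,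
and `l ⟶ k'` is surjective by faithful flatness of `K` over `k`.

If instead `X` is universally closed over `k` and `X ×ₖ l` is normal, then the global functions on
`X` are integral over `k`, hence lie in `k`. By flat base change `X' = X ×ₖ l` has only the elements
of `l` as global functions, and those contain `k'`.
-/

noncomputable section

namespace ElementalExt

open TensorProduct

section FieldExtensions

variable {k l k' K F : Type*} [Field k] [Field l] [Field k'] [Field K] [Field F]

lemma isPurelyInseparable_of_adjoin_range_eq_top [Algebra k l] [Algebra k K] [Algebra K F]
    [Algebra l F] [Algebra k F] [IsScalarTower k K F] [IsScalarTower k l F]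
    [IsPurelyInseparable k l] (hF : Algebra.adjoin K (Set.range (algebraMap l F)) = ⊤) :
    IsPurelyInseparable K F := by
  let q := ringExpChar k
  have : ExpChar K q := expChar_of_injective_algebraMap (algebraMap k K).injective q
  rw [isPurelyInseparable_iff_perfectClosure_eq_top, ← IntermediateField.toSubalgebra_inj,
    IntermediateField.top_toSubalgebra, eq_top_iff, ← hF, Algebra.adjoin_le_iff]
  rintro _ ⟨x, rfl⟩
  obtain ⟨n, c, hc⟩ := IsPurelyInseparable.pow_mem k q x
  refine (mem_perfectClosure_iff_pow_mem q).mpr ⟨n, algebraMap k K c, ?_⟩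
  rw [← IsScalarTower.algebraMap_apply, IsScalarTower.algebraMap_apply k l F, hc, map_pow]

lemma isPurelyInseparable_of_isAlgebraic_imp_mem_range [Algebra k k'] [Algebra k K] [Algebra K F]
    [Algebra k' F] [Algebra k F] [IsScalarTower k K F] [IsScalarTower k k' F]
    [Algebra.IsAlgebraic k k'] [IsPurelyInseparable K F]
    (hK : ∀ x : K, IsAlgebraic k x → x ∈ (algebraMap k K).range) :
    IsPurelyInseparable k k' := by
  let q := ringExpChar k
  have : ExpChar K q := expChar_of_injective_algebraMap (algebraMap k K).injective q
  refine (isPurelyInseparable_iff_pow_mem k q).mpr fun x ↦ ?_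
  obtain ⟨n, y, hy⟩ := IsPurelyInseparable.pow_mem K q (algebraMap k' F x)
  rw [← map_pow] at hy
  obtain ⟨c, rfl⟩ := hK y <| by
    rw [← isAlgebraic_algebraMap_iff (algebraMap K F).injective, hy]
    exact (Algebra.IsAlgebraic.isAlgebraic (x ^ q ^ n)).algebraMap
  refine ⟨n, c, (algebraMap k' F).injective ?_⟩
  rw [← hy, ← IsScalarTower.algebraMap_apply, ← IsScalarTower.algebraMap_apply]

lemma injective_of_forall_exists_pow_mem_range {R S : Type*} [Ring R] [IsReduced R] [Ring S]
    [Nontrivial S] (i : K →+* R) (hi : ∀ z, ∃ n > 0, z ^ n ∈ i.range) (f : R →+* S) :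
    Function.Injective f := by
  refine (injective_iff_map_eq_zero f).mpr fun z hz ↦ ?_
  obtain ⟨n, hn, c, hc⟩ := hi z
  have hfc : (f.comp i) c = 0 := by rw [RingHom.comp_apply, hc, map_pow, hz, zero_pow hn.ne']
  have hc0 : c = 0 := (map_eq_zero (f.comp i)).mp hfc
  rw [hc0, map_zero] at hc
  exact eq_zero_of_pow_eq_zero hc.symm

lemma algebraMap_surjective_of_isReduced_tensorProduct [Algebra k l] [Algebra l k'] [Algebra k k']
    [IsScalarTower k l k'] [Algebra k K] [Algebra K F] [Algebra k' F] [Algebra l F] [Algebra k F]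
    [IsScalarTower k K F] [IsScalarTower k k' F] [IsScalarTower l k' F]
    [IsPurelyInseparable k k'] [IsReduced (K ⊗[k] k')]
    (hF : Algebra.adjoin K (Set.range (algebraMap l F)) = ⊤) :
    Function.Surjective (algebraMap l k') := by
  let m : K ⊗[k] k' →ₐ[K] F := Algebra.TensorProduct.lift (Algebra.ofId K F)
    (IsScalarTower.toAlgHom k k' F) fun _ _ ↦ .all _ _
  let g : K ⊗[k] l →ₐ[K] K ⊗[k] k' :=
    Algebra.TensorProduct.map (.id K K) (IsScalarTower.toAlgHom k l k')
  have m_injective : Function.Injective m :=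
    injective_of_forall_exists_pow_mem_range (algebraMap K (K ⊗[k] k'))
      (IsPurelyInseparable.exists_pow_mem_range_tensorProduct (k := k)) m.toRingHom
  have range_comp : (m.comp g).range = ⊤ := by
    rw [eq_top_iff, ← hF, Algebra.adjoin_le_iff]
    rintro _ ⟨x, rfl⟩
    exact ⟨1 ⊗ₜ x, by simp [m, g, ← IsScalarTower.algebraMap_apply]⟩
  have g_surjective : Function.Surjective g := fun z ↦ by
    obtain ⟨y, hy⟩ : m z ∈ (m.comp g).range := range_comp ▸ trivial
    exact ⟨y, m_injective hy⟩
  exact (Module.FaithfullyFlat.lTensor_surjective_iff_surjective k K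
    (IsScalarTower.toAlgHom k l k').toLinearMap).mp g_surjective

lemma adjoin_eq_top_of_isFractionRing {B : Type*} [CommRing B] [Algebra K F] [Algebra B F]
    [IsFractionRing B F] {s : Set F} (hs : ∀ x ∈ s, IsAlgebraic K x)
    (hB : ∀ b, algebraMap B F b ∈ Algebra.adjoin K s) : Algebra.adjoin K s = ⊤ := by
  rw [← IntermediateField.adjoin_toSubalgebra_of_isAlgebraic hs] at hB ⊢
  refine eq_top_iff.mpr fun x _ ↦ ?_
  obtain ⟨a, b, -, rfl⟩ := IsFractionRing.div_surjective (A := B) x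
  exact (IntermediateField.adjoin K s).div_mem (hB a) (hB b)

end FieldExtensions

section FaithfullyFlat

variable {A B : Type*} [CommRing A] [CommRing B] [Algebra A B] [Module.FaithfullyFlat A B]

lemma algebraMap_dvd_algebraMap_iff_of_faithfullyFlat {a b : A} :
    algebraMap A B a ∣ algebraMap A B b ↔ a ∣ b := by
  rw [← Ideal.mem_span_singleton, ← Ideal.mem_span_singleton, ← Set.image_singleton,
    ← Ideal.map_span, ← Ideal.mem_comap, Ideal.comap_map_eq_self_of_faithfullyFlat]

variable (A B)

lemma isDomain_of_faithfullyFlat [IsDomain B] : IsDomain A :=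
  (FaithfulSMul.algebraMap_injective A B).isDomain

lemma isIntegrallyClosed_of_faithfullyFlat [IsDomain B] [IsIntegrallyClosed B] :
    IsIntegrallyClosed A := by
  have : IsDomain A := isDomain_of_faithfullyFlat A B
  let f : FractionRing A →ₐ[A] FractionRing B := IsFractionRing.liftAlgHom
    (g := Algebra.ofId A (FractionRing B)) (FaithfulSMul.algebraMap_injective A (FractionRing B))
  refine (isIntegrallyClosed_iff (FractionRing A)).mpr fun {x} hx ↦ ?_
  obtain ⟨a, c, hc, rfl⟩ := IsFractionRing.div_surjective (A := A) x
  have hc0 : algebraMap A (FractionRing A) c ≠ 0 := by simpa using nonZeroDivisors.ne_zero hc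
  obtain ⟨b, hb⟩ := IsIntegrallyClosed.isIntegral_iff.mp ((hx.map f).tower_top (A := B))
  have hbc : algebraMap A B c * b = algebraMap A B a := by
    apply IsFractionRing.injective B (FractionRing B)
    rw [map_div₀, eq_div_iff ((map_ne_zero f).mpr hc0), AlgHom.commutes, AlgHom.commutes] at hb
    rw [map_mul, mul_comm, ← IsScalarTower.algebraMap_apply, ← IsScalarTower.algebraMap_apply, hb]
  obtain ⟨d, rfl⟩ := algebraMap_dvd_algebraMap_iff_of_faithfullyFlat.mp ⟨b, hbc.symm⟩
  exact ⟨d, by rw [map_mul, mul_div_cancel_left₀ _ hc0]⟩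

end FaithfullyFlat

section Descent

variable {X Y : Scheme.{u}} (f : X ⟶ Y) [Flat f]

lemma faithfullyFlat_stalkMap (x : X) : (f.stalkMap x).hom.FaithfullyFlat := by
  algebraize [(f.stalkMap x).hom]
  exact @Module.FaithfullyFlat.of_flat_of_isLocalHom _ _ _ _ _ _ _
    (Flat.stalkMap f x) (f.toLRSHom.prop x)

lemma isReduced_of_flat_of_surjective [Surjective f] [IsReduced X] : IsReduced Y := by
  refine @isReduced_of_isReduced_stalk Y fun y ↦ ?_
  obtain ⟨x, rfl⟩ := f.surjective y
  exact isReduced_of_injective _ (faithfullyFlat_stalkMap f x).injective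

lemma isReduced_of_flat_of_isPreimmersion [IsPreimmersion f] [IsReduced Y] : IsReduced X := by
  refine @isReduced_of_isReduced_stalk X fun x ↦ ?_
  let e := RingEquiv.ofBijective (f.stalkMap x).hom
    ⟨(faithfullyFlat_stalkMap f x).injective, f.stalkMap_surjective x⟩
  exact isReduced_of_injective e.symm e.symm.injective

lemma IsNormalScheme.of_flat_of_surjective [Surjective f] (hX : IsNormalScheme X) :
    IsNormalScheme Y := by
  intro y
  obtain ⟨x, rfl⟩ := f.surjective y
  algebraize [(f.stalkMap x).hom]
  have : Module.FaithfullyFlat (Y.presheaf.stalk (f x)) (X.presheaf.stalk x) :=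
    faithfullyFlat_stalkMap f x
  obtain ⟨_, _⟩ := hX x
  exact ⟨isDomain_of_faithfullyFlat _ (X.presheaf.stalk x),
    isIntegrallyClosed_of_faithfullyFlat _ (X.presheaf.stalk x)⟩

end Descent

section Geometrically

lemma exists_field_comp_eq {S T : Scheme.{u}} (g : T ⟶ S) [Surjective g] {K : Type u} [Field K]
    (y : Spec (.of K) ⟶ S) :
    ∃ (M : Type u) (_ : Field M) (i : Spec (.of M) ⟶ Spec (.of K)) (j : Spec (.of M) ⟶ T),
      i ≫ y = j ≫ g := by
  obtain ⟨z, -⟩ := (pullback.fst y g).surjective (IsLocalRing.closedPoint K)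
  let ι := (pullback y g).fromSpecResidueField z
  exact ⟨(pullback y g).residueField z, inferInstance, ι ≫ pullback.fst y g, ι ≫ pullback.snd y g,
    by simp [pullback.condition]⟩

instance {X Y : Scheme.{u}} (f : X ⟶ Y) [Nonempty X] [Subsingleton Y] : Surjective f :=
  ⟨Function.surjective_to_subsingleton _⟩

lemma geometrically_snd_iff {P : ObjectProperty Scheme.{u}}
    (hP : ∀ {Z W : Scheme.{u}} (f : Z ⟶ W) [Flat f] [Surjective f], P Z → P W)
    {X S T : Scheme.{u}} (α : X ⟶ S) (g : T ⟶ S) [Surjective g] :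
    geometrically P (pullback.snd α g) ↔ geometrically P α := by
  refine ⟨fun h K _ y Z fst snd hZ ↦ ?_, MorphismProperty.pullback_snd α g⟩
  -- Enlarge `K` to a field `M` over which `y` lifts to `T`, and descend along `Z ×_K M ⟶ Z`.
  obtain ⟨M, _, i, j, hij⟩ := exists_field_comp_eq g y
  have hM := (IsPullback.of_hasPullback snd i).paste_horiz hZ
  rw [hij] at hM
  let lift : pullback snd i ⟶ pullback α g :=
    pullback.lift (pullback.fst snd i ≫ fst) (pullback.snd snd i ≫ j) (by simpa using hM.w)
  have hM' : IsPullback lift (pullback.snd snd i) (pullback.snd α g) j :=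
    .of_right (by rwa [pullback.lift_fst]) (pullback.lift_snd _ _ _) (.of_hasPullback α g)
  exact hP (pullback.fst snd i) (h _ _ _ hM')

end Geometrically

section GeometricallyReduced

variable {X Z S : Scheme.{u}} (f : Z ⟶ X) (α : X ⟶ S)

lemma geometricallyReduced_of_isSchemeTheoreticallyDominant [IsIntegral S] [Subsingleton S]
    [IsSchemeTheoreticallyDominant f] [QuasiCompact f] [GeometricallyReduced (f ≫ α)] :
    GeometricallyReduced α := by
  refine ⟨fun K _ y W fst snd hW ↦ ?_⟩
  have : Flat fst := MorphismProperty.of_isPullback hW.flip inferInstance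
  have hZ := IsPullback.of_hasPullback f fst
  have : IsReduced (pullback f fst) :=
    GeometricallyReduced.geometrically_isReduced (f := f ≫ α) _ _ _
      (hZ.flip.paste_horiz hW.flip).flip
  exact IsSchemeTheoreticallyDominant.isReduced (pullback.snd f fst)

lemma geometricallyReduced_comp_of_flat_of_isPreimmersion [Flat f] [IsPreimmersion f]
    [GeometricallyReduced α] : GeometricallyReduced (f ≫ α) := by
  refine ⟨fun K _ y W fst snd hW ↦ ?_⟩
  have hZ := (IsPullback.of_hasPullback f (pullback.fst α y)).flip.paste_horiz
    (IsPullback.of_hasPullback α y).flip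
  have : IsReduced (pullback α y) :=
    GeometricallyReduced.geometrically_isReduced _ _ _ (.of_hasPullback α y)
  have : IsReduced (pullback f (pullback.fst α y)) :=
    isReduced_of_flat_of_isPreimmersion (pullback.snd f (pullback.fst α y))
  exact isReduced_of_isOpenImmersion (hW.flip.isoIsPullback _ _ hZ).hom

end GeometricallyReduced

section IsNormalScheme

variable {X : Scheme.{u}}

lemma IsNormalScheme.isReduced (hX : IsNormalScheme X) : IsReduced X :=
  @isReduced_of_isReduced_stalk X fun x ↦ have := (hX x).1; inferInstance

lemma GeometricallyNormal.geometricallyReduced {k : Type u} [Field k] {α : X ⟶ Spec (.of k)}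
    (hα : GeometricallyNormal α) : GeometricallyReduced α :=
  ⟨fun _ _ _ _ _ _ hZ ↦ (hα _ _ _ hZ).isReduced⟩

lemma IsNormalScheme.isIntegrallyClosed [IsIntegral X] (hX : IsNormalScheme X) {U : X.Opens}
    (hU : IsAffineOpen U) [Nonempty U] : IsIntegrallyClosed Γ(X, U) := by
  refine IsIntegrallyClosed.of_localization_maximal fun P _ _ ↦ ?_
  let y : PrimeSpectrum Γ(X, U) := ⟨P, inferInstance⟩
  have hy : hU.fromSpec y ∈ U := by
    rw [← SetLike.mem_coe, ← hU.range_fromSpec]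
    exact ⟨y, rfl⟩
  let : Algebra Γ(X, U) (X.presheaf.stalk (hU.fromSpec y)) :=
    (X.presheaf.germ U _ hy).hom.toAlgebra
  have : IsLocalization P.primeCompl (X.presheaf.stalk (hU.fromSpec y)) :=
    hU.isLocalization_stalk' y hy
  have := (hX (hU.fromSpec y)).2
  exact .of_equiv (IsLocalization.algEquiv P.primeCompl (X.presheaf.stalk (hU.fromSpec y))
    (Localization.AtPrime P)).toRingEquiv

end IsNormalScheme

section Normalisation

instance {X : Scheme.{u}} (x : X) : Flat (X.fromSpecStalk x) := by
  obtain ⟨_, ⟨U, hU, rfl⟩, hxU, -⟩ :=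
    X.isBasis_affineOpens.exists_subset_of_mem_open (Set.mem_univ x) isOpen_univ
  rw [← hU.fromSpecStalk_eq_fromSpecStalk hxU]
  change Flat (Spec.map (X.presheaf.germ U x hxU) ≫ hU.fromSpec)
  have : Flat (Spec.map (X.presheaf.germ U x hxU)) := by
    rw [Flat.SpecMap_iff]
    let : Algebra Γ(X, U) (X.presheaf.stalk x) := (X.presheaf.germ U x hxU).hom.toAlgebra
    have := hU.isLocalization_stalk ⟨x, hxU⟩
    exact IsLocalization.flat (R := Γ(X, U)) (X.presheaf.stalk x)
      (hU.primeIdealOf ⟨x, hxU⟩).asIdeal.primeCompl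
  have := hU.isOpenImmersion_fromSpec
  infer_instance

instance {Y : Scheme.{u}} [IsIntegral Y] : IsDominant (fromSpecFunctionField Y) := by
  refine ⟨dense_iff_closure_eq.mpr <| Set.univ_subset_iff.mp ?_⟩
  rw [← genericPoint_closure (α := Y)]
  exact closure_mono <| Set.singleton_subset_iff.mpr
    ⟨IsLocalRing.closedPoint _, Scheme.fromSpecStalk_closedPoint⟩

lemma isIso_fromNormalization {X Y : Scheme.{u}} (f : X ⟶ Y) [QuasiCompact f] [QuasiSeparated f]
    (hf : ∀ U : Y.Opens, IsAffineOpen U →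
      letI := (f.app U).hom.toAlgebra
      IsIntegrallyClosedIn Γ(Y, U) Γ(X, f ⁻¹ᵁ U)) :
    IsIso f.fromNormalization := by
  rw [← MorphismProperty.isomorphisms.iff,
    IsZariskiLocalAtTarget.iff_of_iSup_eq_top (P := .isomorphisms Scheme.{u}) _
      (iSup_affineOpens_eq_top Y)]
  intro U
  let := (f.app U).hom.toAlgebra
  have := hf U U.2
  have : IsIso (CommRingCat.ofHom
      (algebraMap Γ(Y, U) (integralClosure Γ(Y, U) Γ(X, f ⁻¹ᵁ U)))) := by
    let e := IsIntegralClosure.equiv Γ(Y, U) Γ(Y, U) Γ(X, f ⁻¹ᵁ U)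
      (integralClosure Γ(Y, U) Γ(X, f ⁻¹ᵁ U))
    exact (ConcreteCategory.isIso_iff_bijective _).mpr
      ((funext e.commutes : ⇑e = algebraMap _ _) ▸ e.bijective)
  rw [MorphismProperty.isomorphisms.iff, isIso_morphismRestrict_iff_isIso_app _ U.2,
    f.fromNormalization_app U.2]
  infer_instance

variable {X' Y : Scheme.{u}} [IsIntegral Y] {ν : X' ⟶ Y}

lemma fromSpecFunctionField_preimage_eq_top {U : Y.Opens} (hU : genericPoint Y ∈ U) :
    fromSpecFunctionField Y ⁻¹ᵁ U = ⊤ := by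
  refine top_le_iff.mp fun x _ ↦ ?_
  have hx : fromSpecFunctionField Y x = genericPoint Y := by
    rw [Subsingleton.elim (α := PrimeSpectrum Y.functionField) x (IsLocalRing.closedPoint _)]
    exact Scheme.fromSpecStalk_closedPoint
  change fromSpecFunctionField Y x ∈ U
  rwa [hx]

lemma IsNormalScheme.isIntegrallyClosedIn_app_fromSpecFunctionField (hY : IsNormalScheme Y)
    {U : Y.Opens} (hU : IsAffineOpen U) :
    letI := ((fromSpecFunctionField Y).app U).hom.toAlgebra
    IsIntegrallyClosedIn Γ(Y, U) Γ(Spec Y.functionField, fromSpecFunctionField Y ⁻¹ᵁ U) := by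
  let := ((fromSpecFunctionField Y).app U).hom.toAlgebra
  obtain hne | hne := isEmpty_or_nonempty U
  · obtain rfl : U = ⊥ :=
      TopologicalSpace.Opens.ext (Set.isEmpty_coe_sort.mp hne)
    have : Subsingleton Γ(Spec Y.functionField, fromSpecFunctionField Y ⁻¹ᵁ ⊥) := by
      rw [Scheme.Hom.preimage_bot]
      infer_instance
    exact isIntegrallyClosedIn_iff.mpr
      ⟨Function.injective_of_subsingleton _, fun _ ↦ ⟨0, Subsingleton.elim _ _⟩⟩
  have hη : genericPoint Y ∈ U :=
    ((genericPoint_spec Y).mem_open_set_iff U.isOpen).mpr (by simpa using hne)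
  have := functionField_isFractionRing_of_isAffineOpen Y U hU
  have := (isIntegrallyClosed_iff_isIntegrallyClosedIn Y.functionField).mp
    (hY.isIntegrallyClosed hU)
  let e := (Scheme.ΓSpecIso Y.functionField).symm ≪≫
    (Spec Y.functionField).presheaf.mapIso
      (eqToIso (fromSpecFunctionField_preimage_eq_top hη)).op
  exact (AlgEquiv.ofRingEquiv (f := e.commRingCatIsoToRingEquiv) fun x ↦
    congr($(Scheme.fromSpecStalk_app hη).hom x).symm).isIntegrallyClosedIn.mp this

lemma IsNormalisation.isIso (hν : IsNormalisation ν) (hY : IsNormalScheme Y) : IsIso ν := by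
  obtain ⟨e, rfl⟩ := hν
  have : IsIso (fromNormalisation Y) := isIso_fromNormalization (fromSpecFunctionField Y)
    fun U hU ↦ hY.isIntegrallyClosedIn_app_fromSpecFunctionField hU
  infer_instance

lemma IsNormalisation.isIntegralHom (hν : IsNormalisation ν) : IsIntegralHom ν := by
  obtain ⟨e, rfl⟩ := hν
  have : IsIntegralHom (fromNormalisation Y) :=
    inferInstanceAs (IsIntegralHom (fromSpecFunctionField Y).fromNormalization)
  infer_instance

lemma IsNormalisation.exists_isSchemeTheoreticallyDominant (hν : IsNormalisation ν) :
    ∃ t : Spec Y.functionField ⟶ X', IsSchemeTheoreticallyDominant t ∧ QuasiCompact t ∧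
      t ≫ ν = fromSpecFunctionField Y := by
  obtain ⟨e, rfl⟩ := hν
  let τ : Spec Y.functionField ⟶ normalisation Y := (fromSpecFunctionField Y).toNormalization
  have hτ : τ ≫ fromNormalisation Y = fromSpecFunctionField Y :=
    Scheme.Hom.toNormalization_fromNormalization _
  have : IsSchemeTheoreticallyDominant τ :=
    ⟨Scheme.Hom.ker_toNormalization (fromSpecFunctionField Y)⟩
  have : QuasiCompact τ := inferInstanceAs (QuasiCompact (fromSpecFunctionField Y).toNormalization)
  exact ⟨τ ≫ e.inv, inferInstance, inferInstance, by simpa using hτ⟩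

lemma IsNormalisation.isSchemeTheoreticallyDominant (hν : IsNormalisation ν) :
    IsSchemeTheoreticallyDominant ν := by
  obtain ⟨t, -, -, ht⟩ := hν.exists_isSchemeTheoreticallyDominant
  have : IsDominant (t ≫ ν) := ht ▸ inferInstance
  have : IsDominant ν := .of_comp t ν
  exact .of_isDominant ν

lemma IsNormalisation.geometricallyReduced_comp_iff (hν : IsNormalisation ν) {S : Scheme.{u}}
    [IsIntegral S] [Subsingleton S] (β : Y ⟶ S) :
    GeometricallyReduced (ν ≫ β) ↔ GeometricallyReduced β := by
  refine ⟨fun _ ↦ ?_, fun _ ↦ ?_⟩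
  · have := hν.isSchemeTheoreticallyDominant
    have := hν.isIntegralHom
    exact geometricallyReduced_of_isSchemeTheoreticallyDominant ν β
  · -- `X'` is sandwiched between `Spec K(Y)` and `Y`.
    obtain ⟨t, _, _, ht⟩ := hν.exists_isSchemeTheoreticallyDominant
    have : GeometricallyReduced (t ≫ ν ≫ β) := by
      rw [reassoc_of% ht]
      exact geometricallyReduced_comp_of_flat_of_isPreimmersion _ β
    exact geometricallyReduced_of_isSchemeTheoreticallyDominant t (ν ≫ β)

end Normalisation

section GlobalSections

lemma mem_algClosureIn {k K : Type u} [Field k] [Field K] {f : k →+* K} {x : K} :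
    x ∈ algClosureIn f ↔ letI := f.toAlgebra; IsAlgebraic k x :=
  letI := f.toAlgebra
  mem_algebraicClosure_iff (F := k)

lemma isPushout_pullback_app {X S T : Scheme.{u}} [IsAffine S] [IsAffine T] (α : X ⟶ S)
    (g : T ⟶ S) [Flat g] {U : X.Opens} (hU : IsCompact (U : Set X))
    (hU' : IsQuasiSeparated (U : Set X)) :
    IsPushout (α.appLE ⊤ U le_top) g.appTop ((pullback.fst α g).app U)
      ((pullback.snd α g).appLE ⊤ (pullback.fst α g ⁻¹ᵁ U) le_top) := by
  have := isIso_pushoutSection_of_isQuasiSeparated_of_flat_right (.of_hasPullback α g)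
    (US := ⊤) (UT := ⊤) (UX := U) (UY := pullback.fst α g ⁻¹ᵁ U) le_top le_top
    (by rw [Scheme.Hom.preimage_top, inf_top_eq]) (isAffineOpen_top _) (isAffineOpen_top _) hU hU'
  rw [Scheme.Hom.app_eq_appLE, Scheme.Hom.appTop, Scheme.Hom.app_eq_appLE]
  exact (isIso_pushoutSection_iff _ _ _ _).mp this

lemma isIso_appTop_snd {X S T : Scheme.{u}} [IsAffine S] [IsAffine T] (α : X ⟶ S)
    (g : T ⟶ S) [Flat g] [QuasiCompact α] [QuasiSeparated α] [IsIso α.appTop] :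
    IsIso (pullback.snd α g).appTop := by
  have : CompactSpace X := (quasiCompact_iff_compactSpace α).mp inferInstance
  have : QuasiSeparatedSpace X := (quasiSeparated_iff_quasiSeparatedSpace α).mp inferInstance
  have H : IsPushout α.appTop g.appTop (pullback.fst α g).appTop (pullback.snd α g).appTop := by
    rw [← show α.appLE ⊤ ⊤ le_top = α.appTop from α.appLE_eq_app,
      ← show (pullback.snd α g).appLE ⊤ ⊤ le_top = (pullback.snd α g).appTop from
        (pullback.snd α g).appLE_eq_app]
    exact isPushout_pullback_app α g isCompact_univ isQuasiSeparated_univ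
  exact H.isIso_inr_of_isIso

lemma surjective_of_isIso_appTop_comp {l k' : Type u} [Field l] [Field k'] (i : l →+* k')
    {X : Scheme.{u}} [IsIntegral X] (α : X ⟶ Spec (.of k'))
    [IsIso (α ≫ Spec.map (CommRingCat.ofHom i)).appTop] : Function.Surjective i := by
  let g := (Scheme.ΓSpecIso (.of k')).inv ≫ α.appTop
  have hg : CommRingCat.ofHom i ≫ g =
      (Scheme.ΓSpecIso (.of l)).inv ≫ (α ≫ Spec.map (CommRingCat.ofHom i)).appTop := by
    simp [g]
  have : IsIso (CommRingCat.ofHom i ≫ g) := hg ▸ inferInstance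
  intro x
  obtain ⟨y, hy⟩ := (ConcreteCategory.bijective_of_isIso (CommRingCat.ofHom i ≫ g)).2 (g x)
  exact ⟨y, RingHom.injective (R := k') g.hom hy⟩

lemma IsVarietyWithClosedBase.isIso_appTop {k : Type u} [Field k] {X : Scheme.{u}}
    {α : X ⟶ Spec (.of k)} (hα : IsVarietyWithClosedBase α) [UniversallyClosed α] :
    IsIso α.appTop := by
  have := hα.isIntegral
  let g := (Scheme.ΓSpecIso (.of k)).inv ≫ α.appTop
  let γ := (X.presheaf.germ ⊤ (genericPoint X) trivial).hom
  have g_isIntegral : g.hom.IsIntegral := RingHom.isIntegral_respectsIso.2 α.appTop.hom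
    (Scheme.ΓSpecIso (.of k)).symm.commRingCatIsoToRingEquiv
    (isIntegral_appTop_of_universallyClosed α)
  have : IsIso g := by
    refine (ConcreteCategory.isIso_iff_bijective g).mpr
      ⟨RingHom.injective (R := k) g.hom, fun s ↦ ?_⟩
    have hs : γ s ∈ (toFunctionField α).fieldRange := by
      rw [hα.algClosed, mem_algClosureIn]
      let := (toFunctionField α).toAlgebra
      exact IsIntegral.isAlgebraic (R := k) ((g_isIntegral s).map γ)
    obtain ⟨x, hx⟩ := hs
    exact ⟨x, germ_injective_of_isIntegral X (U := ⊤) _ trivial hx⟩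
  exact IsIso.of_isIso_comp_left (Scheme.ΓSpecIso (.of k)).inv α.appTop

end GlobalSections

section FunctionFields

variable {X Y : Scheme.{u}} [IsIntegral X] [IsIntegral Y]

lemma specializes_genericPoint_of_isDominant (f : Y ⟶ X) [IsDominant f] :
    f (genericPoint Y) ⤳ genericPoint X := by
  have h := (genericPoint_spec Y).image f.continuous
  rw [Set.image_univ, f.denseRange.closure_range] at h
  rw [h.eq (genericPoint_spec X)]

/-- The homomorphism `K(X) ⟶ K(Y)` induced by a dominant morphism `f : Y ⟶ X`, i.e. the stalk map
at the generic point of `Y`. -/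
def functionFieldMap (f : Y ⟶ X) [IsDominant f] : X.functionField ⟶ Y.functionField :=
  X.presheaf.stalkSpecializes (specializes_genericPoint_of_isDominant f) ≫
    f.stalkMap (genericPoint Y)

lemma specMap_functionFieldMap_comp (f : Y ⟶ X) [IsDominant f] :
    Spec.map (functionFieldMap f) ≫ fromSpecFunctionField X = fromSpecFunctionField Y ≫ f := by
  rw [functionFieldMap, Spec.map_comp, Category.assoc,
    Scheme.SpecMap_stalkSpecializes_fromSpecStalk, Scheme.SpecMap_stalkMap_fromSpecStalk]

lemma germ_functionFieldMap (f : Y ⟶ X) [IsDominant f] {U : X.Opens} (hU : genericPoint X ∈ U) :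
    X.presheaf.germ U _ hU ≫ functionFieldMap f = f.app U ≫ Y.presheaf.germ (f ⁻¹ᵁ U) _
      ((specializes_genericPoint_of_isDominant f).mem_open U.isOpen hU) := by
  rw [functionFieldMap, TopCat.Presheaf.germ_stalkSpecializes_assoc, Scheme.Hom.germ_stalkMap]

variable {k l : Type u} [Field k] [Field l] (α : X ⟶ Spec (.of k))

lemma appLE_germ_genericPoint {U : X.Opens} (hU : genericPoint X ∈ U) :
    α.appLE ⊤ U le_top ≫ X.presheaf.germ U _ hU =
      (Scheme.ΓSpecIso (.of k)).hom ≫ CommRingCat.ofHom (toFunctionField α) := by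
  change (α.appTop ≫ X.presheaf.map (homOfLE le_top).op) ≫ X.presheaf.germ U _ hU = _
  rw [Category.assoc, TopCat.Presheaf.germ_res, ← Iso.inv_comp_eq]
  rfl

lemma fromSpecFunctionField_comp :
    fromSpecFunctionField X ≫ α = Spec.map (CommRingCat.ofHom (toFunctionField α)) := by
  apply ext_of_isAffine
  rw [Scheme.Hom.comp_appTop, Scheme.fromSpecStalk_appTop, ← cancel_mono (Scheme.ΓSpecIso _).hom,
    Scheme.ΓSpecIso_naturality, ← Iso.inv_comp_eq]
  simp [toFunctionField]

lemma toFunctionField_comp_specMap (f : l →+* k) :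
    toFunctionField (α ≫ Spec.map (CommRingCat.ofHom f)) = (toFunctionField α).comp f := by
  have h := fromSpecFunctionField_comp (α ≫ Spec.map (CommRingCat.ofHom f))
  rw [← Category.assoc, fromSpecFunctionField_comp, ← Spec.map_comp, ← CommRingCat.ofHom_comp] at h
  exact congr($(Spec.map_injective h.symm).hom)

lemma toFunctionField_comp (f : Y ⟶ X) [IsDominant f] :
    toFunctionField (f ≫ α) = (functionFieldMap f).hom.comp (toFunctionField α) := by
  have h := fromSpecFunctionField_comp (f ≫ α)
  rw [← Category.assoc, ← specMap_functionFieldMap_comp, Category.assoc,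
    fromSpecFunctionField_comp, ← Spec.map_comp] at h
  exact congr($(Spec.map_injective h.symm).hom)

lemma isReduced_functionField_tensorProduct [GeometricallyReduced α] (K : Type u) [Field K]
    [Algebra k K] :
    letI := (toFunctionField α).toAlgebra
    _root_.IsReduced (X.functionField ⊗[k] K) := by
  let := (toFunctionField α).toAlgebra
  have h : GeometricallyReduced (fromSpecFunctionField X ≫ α) :=
    geometricallyReduced_comp_of_flat_of_isPreimmersion _ _
  rw [fromSpecFunctionField_comp] at h
  have H := (CommRingCat.isPushout_tensorProduct k X.functionField K).op.map Scheme.Spec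
  exact (affine_isReduced_iff _).mp (h.geometrically_isReduced _ _ _ H.flip)

variable [Algebra k l] [IsIntegral (baseChange α l)]

lemma functionFieldMap_fst_comp_toFunctionField :
    (functionFieldMap (Y := baseChange α l) (pullback.fst α _)).hom.comp (toFunctionField α) =
      (toFunctionField (X := baseChange α l) (pullback.snd α _)).comp (algebraMap k l) := by
  rw [← toFunctionField_comp, ← toFunctionField_comp_specMap]
  congr 1
  exact pullback.condition

lemma germ_mem_adjoin_range_toFunctionField {U : X.Opens} (hU : IsCompact (U : Set X))
    (hU' : IsQuasiSeparated (U : Set X)) (hη : genericPoint X ∈ U)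
    (hη' : genericPoint (baseChange α l) ∈
      pullback.fst α (Spec.map (CommRingCat.ofHom (algebraMap k l))) ⁻¹ᵁ U)
    (c : Γ(baseChange α l, pullback.fst α _ ⁻¹ᵁ U)) :
    letI := (functionFieldMap (Y := baseChange α l) (pullback.fst α _)).hom.toAlgebra
    (baseChange α l).presheaf.germ _ _ hη' c ∈ Algebra.adjoin X.functionField
      (Set.range (toFunctionField (X := baseChange α l) (pullback.snd α _))) := by
  let π₁ : baseChange α l ⟶ X := pullback.fst _ _
  let π₂ : baseChange α l ⟶ Spec (.of l) := pullback.snd _ _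
  let := (functionFieldMap π₁).hom.toAlgebra
  let S := Algebra.adjoin X.functionField (Set.range (toFunctionField π₂))
  let γ := (baseChange α l).presheaf.germ (π₁ ⁻¹ᵁ U) _ hη'
  suffices S.toSubring.comap γ.hom = ⊤ from (this ▸ trivial : c ∈ S.toSubring.comap γ.hom)
  have H := isPushout_pullback_app α (Spec.map (CommRingCat.ofHom (algebraMap k l))) hU hU'
  rw [eq_top_iff, ← CommRingCat.closure_range_union_range_eq_top_of_isPushout H,
    Subring.closure_le]
  rintro _ (⟨x, rfl⟩ | ⟨x, rfl⟩)
  · have hx : γ (π₁.app U x) = functionFieldMap π₁ (X.presheaf.germ U _ hη x) :=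
      (ConcreteCategory.congr_hom (germ_functionFieldMap π₁ hη) x).symm
    change γ (π₁.app U x) ∈ S
    exact hx ▸ S.algebraMap_mem (X.presheaf.germ U _ hη x)
  · exact Algebra.subset_adjoin ⟨(Scheme.ΓSpecIso (.of l)).hom x,
      (ConcreteCategory.congr_hom (appLE_germ_genericPoint π₂ hη') x).symm⟩

lemma adjoin_range_toFunctionField_eq_top [Algebra.IsAlgebraic k l] :
    letI := (functionFieldMap (Y := baseChange α l) (pullback.fst α _)).hom.toAlgebra
    Algebra.adjoin X.functionField
      (Set.range (toFunctionField (X := baseChange α l) (pullback.snd α _))) = ⊤ := by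
  let π₁ : baseChange α l ⟶ X := pullback.fst _ _
  let π₂ : baseChange α l ⟶ Spec (.of l) := pullback.snd _ _
  let := (functionFieldMap π₁).hom.toAlgebra
  have isAlgebraic (x : l) : IsAlgebraic X.functionField (toFunctionField π₂ x) := by
    let := (toFunctionField α).toAlgebra
    let := (toFunctionField π₂).toAlgebra
    let := ((toFunctionField π₂).comp (algebraMap k l)).toAlgebra
    have : IsScalarTower k X.functionField (baseChange α l).functionField :=
      .of_algebraMap_eq' (functionFieldMap_fst_comp_toFunctionField α).symm
    have : IsScalarTower k l (baseChange α l).functionField := .of_algebraMap_eq' rfl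
    exact ((Algebra.IsAlgebraic.isAlgebraic (R := k) x).algebraMap).tower_top X.functionField
  obtain ⟨_, ⟨U, hU, rfl⟩, hη, -⟩ :=
    X.isBasis_affineOpens.exists_subset_of_mem_open (Set.mem_univ (genericPoint X)) isOpen_univ
  have hη' : genericPoint (baseChange α l) ∈ π₁ ⁻¹ᵁ U :=
    (specializes_genericPoint_of_isDominant π₁).mem_open U.isOpen hη
  have : Nonempty (π₁ ⁻¹ᵁ U) := ⟨⟨_, hη'⟩⟩
  have : IsAffineHom π₁ := MorphismProperty.of_isPullback (P := @IsAffineHom)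
    (IsPullback.of_hasPullback α (Spec.map (CommRingCat.ofHom (algebraMap k l)))).flip inferInstance
  have := functionField_isFractionRing_of_isAffineOpen (baseChange α l) (π₁ ⁻¹ᵁ U) (hU.preimage π₁)
  exact adjoin_eq_top_of_isFractionRing (B := Γ(baseChange α l, π₁ ⁻¹ᵁ U))
    (Set.forall_mem_range.mpr isAlgebraic)
    (germ_mem_adjoin_range_toFunctionField α hU.isCompact hU.isQuasiSeparated hη hη')

end FunctionFields

section ElementalExtension

variable {p : ℕ} {k l k' : Type u} [Field k] [Field l] [Field k'] [Algebra k l] [Algebra l k']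
  {X X' : Scheme.{u}} {α : X ⟶ Spec (.of k)} {α' : X' ⟶ Spec (.of k')} {φ : X' ⟶ X}

lemma isIso_specMap_algebraMap (hl : Function.Bijective (algebraMap l k')) :
    IsIso (Spec.map (CommRingCat.ofHom (algebraMap l k'))) := by
  have : IsIso (CommRingCat.ofHom (algebraMap l k')) :=
    (ConcreteCategory.isIso_iff_bijective _).mpr hl
  infer_instance

namespace IsElementalExtension

lemma universallyClosed (h : IsElementalExtension p (l := l) α α' φ) [UniversallyClosed α] :
    UniversallyClosed α' := by
  have := h.isIntegral_baseChange
  have := h.isNormalisation.isIntegralHom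
  have : UniversallyClosed (α' ≫ Spec.map (CommRingCat.ofHom (algebraMap l k'))) := by
    rw [← pullback.lift_snd _ _ h.comm]
    infer_instance
  exact .of_comp_of_isSeparated α' (Spec.map (CommRingCat.ofHom (algebraMap l k')))

lemma bijective_of_isNormalScheme_baseChange (h : IsElementalExtension p (l := l) α α' φ)
    [UniversallyClosed α] (hl : IsNormalScheme (baseChange α l)) :
    Function.Bijective (algebraMap l k') := by
  have := h.isIntegral_baseChange
  have := h.isNormalisation.isIso hl
  have := h.isNormalisation.isIntegral
  have := h.isVarietyWithClosedBase.quasiCompact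
  have := h.isVarietyWithClosedBase.isSeparated
  have := h.isVarietyWithClosedBase.isIso_appTop
  have : IsIso (α' ≫ Spec.map (CommRingCat.ofHom (algebraMap l k'))).appTop := by
    have := isIso_appTop_snd α (Spec.map (CommRingCat.ofHom (algebraMap k l)))
    have (f : X' ⟶ baseChange α l) [IsIso f] : IsIso f.appTop := inferInstanceAs (IsIso (f.app ⊤))
    rw [← pullback.lift_snd _ _ h.comm, Scheme.Hom.comp_appTop]
    infer_instance
  exact ⟨(algebraMap l k').injective, surjective_of_isIso_appTop_comp _ α'⟩

lemma isAlgebraic (h : IsElementalExtension p (l := l) α α' φ) : Algebra.IsAlgebraic l k' := by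
  have := h.isIntegral_baseChange
  have := h.isNormalisation.isIntegral
  refine ⟨fun x ↦ ?_⟩
  have hx : toFunctionField α' x ∈ (toFunctionField α').fieldRange := ⟨x, rfl⟩
  rw [h.algClosure, toFunctionField_comp_specMap, mem_algClosureIn] at hx
  let := (toFunctionField α').toAlgebra
  let := ((toFunctionField α').comp (algebraMap l k')).toAlgebra
  have : IsScalarTower l k' X'.functionField := .of_algebraMap_eq' rfl
  exact (isAlgebraic_algebraMap_iff (algebraMap k' X'.functionField).injective).mp hx

lemma exists_comp_algebraMap_eq_toFunctionField (h : IsElementalExtension p (l := l) α α' φ)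
    [IsIntegral (baseChange α l)] :
    ∃ β : k' →+* (baseChange α l).functionField,
      β.comp (algebraMap l k') = toFunctionField (X := baseChange α l) (pullback.snd α _) := by
  obtain ⟨t, -, -, ht⟩ := h.isNormalisation.exists_isSchemeTheoreticallyDominant
  let β : CommRingCat.of k' ⟶ (baseChange α l).functionField := Spec.preimage (t ≫ α')
  have hβ : CommRingCat.ofHom (algebraMap l k') ≫ β =
      CommRingCat.ofHom (toFunctionField (X := baseChange α l) (pullback.snd α _)) := by
    apply Spec.map_injective
    rw [← fromSpecFunctionField_comp, Spec.map_comp, Spec.map_preimage, Category.assoc, ← ht,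
      Category.assoc, pullback.lift_snd]
  exact ⟨β.hom, congr($(hβ).hom)⟩

lemma bijective_of_geometricallyReduced (h : IsElementalExtension p (l := l) α α' φ)
    [GeometricallyReduced α] : Function.Bijective (algebraMap l k') := by
  have := h.isVarietyWithClosedBase.isIntegral
  have := h.isIntegral_baseChange
  have := h.isPurelyInseparable
  have := h.isAlgebraic
  let ι := toFunctionField (X := baseChange α l) (pullback.snd α _)
  obtain ⟨β, hβ⟩ : ∃ β, RingHom.comp β (algebraMap l k') = ι :=
    h.exists_comp_algebraMap_eq_toFunctionField
  let F := (baseChange α l).functionField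
  let := ((algebraMap l k').comp (algebraMap k l)).toAlgebra
  let := (toFunctionField α).toAlgebra
  let := (functionFieldMap (Y := baseChange α l) (pullback.fst α _)).hom.toAlgebra
  let : Algebra k' F := β.toAlgebra
  let : Algebra l F := ι.toAlgebra
  let : Algebra k F := (ι.comp (algebraMap k l)).toAlgebra
  have : IsScalarTower k l k' := .of_algebraMap_eq' rfl
  have : IsScalarTower k l F := .of_algebraMap_eq' rfl
  have : IsScalarTower k X.functionField F :=
    .of_algebraMap_eq' (functionFieldMap_fst_comp_toFunctionField α).symm
  have : IsScalarTower l k' F := .of_algebraMap_eq' hβ.symm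
  have : IsScalarTower k k' F := .of_algebraMap_eq' congr(($hβ).comp (algebraMap k l)).symm
  have : Algebra.IsAlgebraic k k' := .trans k l k'
  have := isReduced_functionField_tensorProduct α k'
  have hF : Algebra.adjoin X.functionField (Set.range (algebraMap l F)) = ⊤ :=
    adjoin_range_toFunctionField_eq_top α
  have : IsPurelyInseparable X.functionField F :=
    isPurelyInseparable_of_adjoin_range_eq_top (k := k) hF
  have : IsPurelyInseparable k k' :=
    isPurelyInseparable_of_isAlgebraic_imp_mem_range (K := X.functionField) (F := F) fun x hx ↦ by
      change x ∈ (toFunctionField α).fieldRange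
      rwa [h.isVarietyWithClosedBase.algClosed, mem_algClosureIn]
  exact ⟨(algebraMap l k').injective,
    algebraMap_surjective_of_isReduced_tensorProduct (k := k) hF⟩

lemma geometricallyNormal_iff (h : IsElementalExtension p (l := l) α α' φ) :
    GeometricallyNormal α ↔ GeometricallyNormal α' ∧
      IsNormalScheme (baseChange α l) ∧ Function.Bijective (algebraMap l k') := by
  suffices H : IsNormalScheme (baseChange α l) → Function.Bijective (algebraMap l k') →
      (GeometricallyNormal α' ↔ GeometricallyNormal α) by
    refine ⟨fun hα ↦ ?_, fun ⟨hα', hl, hk'⟩ ↦ (H hl hk').mp hα'⟩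
    have hl : IsNormalScheme (baseChange α l) := pullback_of_geometrically hα _ _
    have := hα.geometricallyReduced
    exact ⟨(H hl h.bijective_of_geometricallyReduced).mpr hα, hl,
      h.bijective_of_geometricallyReduced⟩
  intro hl hk'
  have := h.isIntegral_baseChange
  have := h.isNormalisation.isIso hl
  have := isIso_specMap_algebraMap hk'
  let P : MorphismProperty Scheme.{u} := geometrically fun Y ↦ IsNormalScheme Y
  calc P α' ↔ P (α' ≫ Spec.map (CommRingCat.ofHom (algebraMap l k'))) :=
        (P.cancel_right_of_respectsIso α' _).symm
    _ ↔ P (pullback.snd α (Spec.map (CommRingCat.ofHom (algebraMap k l)))) := by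
        rw [← pullback.lift_snd _ _ h.comm]
        exact P.cancel_left_of_respectsIso _ _
    _ ↔ P α := geometrically_snd_iff (fun f _ _ ↦ IsNormalScheme.of_flat_of_surjective f) α _

lemma geometricallyReduced_iff (h : IsElementalExtension p (l := l) α α' φ) :
    GeometricallyReduced α ↔ GeometricallyReduced α' ∧ Function.Bijective (algebraMap l k') := by
  suffices H : Function.Bijective (algebraMap l k') →
      (GeometricallyReduced α' ↔ GeometricallyReduced α) from
    ⟨fun hα ↦ ⟨(H h.bijective_of_geometricallyReduced).mpr hα,
      h.bijective_of_geometricallyReduced⟩, fun ⟨hα', hk'⟩ ↦ (H hk').mp hα'⟩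
  intro hk'
  have := h.isIntegral_baseChange
  have := isIso_specMap_algebraMap hk'
  have : MorphismProperty.RespectsIso @GeometricallyReduced :=
    MorphismProperty.IsStableUnderBaseChange.respectsIso
  calc GeometricallyReduced α' ↔
        GeometricallyReduced (α' ≫ Spec.map (CommRingCat.ofHom (algebraMap l k'))) :=
        (MorphismProperty.cancel_right_of_respectsIso @GeometricallyReduced α' _).symm
    _ ↔ GeometricallyReduced
        (pullback.snd α (Spec.map (CommRingCat.ofHom (algebraMap k l)))) := by
        rw [← pullback.lift_snd _ _ h.comm]
        exact h.isNormalisation.geometricallyReduced_comp_iff _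
    _ ↔ GeometricallyReduced α := by
        simp only [AlgebraicGeometry.geometricallyReduced_iff]
        exact geometrically_snd_iff (P := fun Y ↦ IsReduced Y)
          (fun f _ _ _ ↦ isReduced_of_flat_of_surjective f) α _

end IsElementalExtension

end ElementalExtension

section Tower

lemma zero_iff_last_and_forall {n : ℕ} {P : Fin (n + 1) → Prop} {Q : Fin n → Prop}
    (h : ∀ i, P i.castSucc ↔ P i.succ ∧ Q i) : P 0 ↔ P (Fin.last n) ∧ ∀ i, Q i := by
  induction n with
  | zero => simp
  | succ n ih =>
    have hsucc := ih (P := fun i ↦ P i.succ) (Q := fun i ↦ Q i.succ) fun i ↦ h i.succ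
    have h0 : P 0 ↔ P (Fin.succ 0) ∧ Q 0 := h 0
    rw [h0, hsucc, Fin.forall_fin_succ, Fin.succ_last, and_assoc, and_comm (b := Q 0)]

end Tower

end ElementalExt

end

theorem mainTheorem5_general (p n : ℕ)
    (k : Fin (n + 1) → Type u) [∀ i, Field (k i)]
    (l : Fin n → Type u) [∀ i, Field (l i)]
    [∀ i, Algebra (k i.castSucc) (l i)] [∀ i, Algebra (l i) (k i.succ)]
    (X : Fin (n + 1) → Scheme.{u}) (α : ∀ i, X i ⟶ Spec (.of (k i)))
    (φ : ∀ i : Fin n, X i.succ ⟶ X i.castSucc)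
    (hφ : ∀ i : Fin n, ElementalExt.IsElementalExtension p (l := l i)
      (α i.castSucc) (α i.succ) (φ i)) :
    (ElementalExt.GeometricallyNormal (α 0) ↔
      ElementalExt.GeometricallyNormal (α (Fin.last n)) ∧ ∀ i : Fin n,
        ElementalExt.IsNormalScheme (ElementalExt.baseChange (α i.castSucc) (l i)) ∧
        Function.Bijective (algebraMap (l i) (k i.succ))) ∧
    (UniversallyClosed (α 0) →
      ((∀ i : Fin n,
        ElementalExt.IsNormalScheme (ElementalExt.baseChange (α i.castSucc) (l i)) ∧
        Function.Bijective (algebraMap (l i) (k i.succ))) ↔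
        ∀ i : Fin n,
          ElementalExt.IsNormalScheme (ElementalExt.baseChange (α i.castSucc) (l i)))) ∧
    (GeometricallyReduced (α 0) ↔ GeometricallyReduced (α (Fin.last n)) ∧
      ∀ i : Fin n, Function.Bijective (algebraMap (l i) (k i.succ))) := by
  refine ⟨ElementalExt.zero_iff_last_and_forall
      (P := fun i ↦ ElementalExt.GeometricallyNormal (α i))
      fun i ↦ (hφ i).geometricallyNormal_iff, fun h0 ↦ ?_,
    ElementalExt.zero_iff_last_and_forall (P := fun i ↦ GeometricallyReduced (α i))
      fun i ↦ (hφ i).geometricallyReduced_iff⟩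
  have universallyClosed (i) : UniversallyClosed (α i) :=
    Fin.induction h0 (fun i _ ↦ (hφ i).universallyClosed) i
  exact forall_congr' fun i ↦ and_iff_left_of_imp (hφ i).bijective_of_isNormalScheme_baseChange

theorem mainTheorem5 (p : ℕ) [Fact p.Prime] (n : ℕ)
    (k : Fin (n + 1) → Type u) [∀ i, Field (k i)] [CharP (k 0) p]
    (l : Fin n → Type u) [∀ i, Field (l i)]
    [∀ i, Algebra (k i.castSucc) (l i)] [∀ i, Algebra (l i) (k i.succ)]
    (X : Fin (n + 1) → Scheme.{u}) (α : ∀ i, X i ⟶ Spec (.of (k i)))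
    (φ : ∀ i : Fin n, X i.succ ⟶ X i.castSucc)
    (hX : ElementalExt.IsNormalScheme (X 0))
    (hα : ElementalExt.IsVarietyWithClosedBase (α 0))
    (hφ : ∀ i : Fin n, ElementalExt.IsElementalExtension p (l := l i)
      (α i.castSucc) (α i.succ) (φ i)) :
    (ElementalExt.GeometricallyNormal (α (Fin.last n)) →
      (ElementalExt.GeometricallyNormal (α 0) ↔
        ∀ i : Fin n,
          ElementalExt.IsNormalScheme (ElementalExt.baseChange (α i.castSucc) (l i)) ∧
          Function.Bijective (algebraMap (l i) (k i.succ))) ∧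
      (IsProper (α 0) →
        ((ElementalExt.GeometricallyNormal (α 0) ↔
          ∀ i : Fin n,
            ElementalExt.IsNormalScheme (ElementalExt.baseChange (α i.castSucc) (l i))) ∧
        ((∀ i : Fin n,
          ElementalExt.IsNormalScheme (ElementalExt.baseChange (α i.castSucc) (l i)) ∧
          Function.Bijective (algebraMap (l i) (k i.succ))) ↔
          ∀ i : Fin n,
            ElementalExt.IsNormalScheme (ElementalExt.baseChange (α i.castSucc) (l i)))))) ∧
    (GeometricallyReduced (α (Fin.last n)) →
      (GeometricallyReduced (α 0) ↔
        ∀ i : Fin n, Function.Bijective (algebraMap (l i) (k i.succ)))) := by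
  obtain ⟨hN, hC, hR⟩ := mainTheorem5_general p n k l X α φ hφ
  exact ⟨fun h ↦ ⟨by simp [hN, h], fun _ ↦ by simp [hN, h, hC inferInstance]⟩,
    fun h ↦ by simp [hR, h]⟩
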